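/- \textbf{Theorem (Compactness).} Let $\Omega\subseteq\mathbb{R}^n$ be a bounded open set and let $\mathcal N\subseteq\mathbb{R}^\ell$ be compact. Let $j:\mathbb{R}^n\to[0,+\infty]$ be a measurable kernel such that \begin{itemize} \item (J1) $j(-z)=j(z)$ for all $z\in\mathbb{R}^n$; \item (J2) $\int_{\mathbb{R}^n}\min\{1,|z|^2\}\,j(z)\,dz<+\infty$; \item (J3) $j\notin L^1(B_R)$ for every $R>0$, where $B_R$ is the ball of radius $R$ centred at the origin. \end{itemize} Let $\Lambda\ge 1$, let $\psi:\mathcal N\times\mathcal N\to[0,+\infty)$ satisfy $\frac1\Lambda|p-q|^2\le\psi(p,q)\le\Lambda|p-q|^2$ for all $p,q\in\mathcal N$, and let $K:\Omega\times\Omega\to[0,+\infty]$ be measurable with $\frac1\Lambda\,j(x-y)\le K(x,y)$ for a.e. $x,y\in\Omega$. With the convention $0\cdot\infty=0$, for $m\in L^2(\Omega;\mathbb{R}^\ell)$ with $m\in\mathcal N$ a.e. in $\Omega$ set $$\mathcal K_\Omega(m)=\iint_{\Omega\times\Omega}K(x,y)\,|m(x)-m(y)|^2\,dx\,dy,\qquad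 \mathcal F_\Omega(m)=\iint_{\Omega\times\Omega}K(x,y)\,\psi(m(x),m(y))\,dx\,dy,$$ and let $$\mathcal X^K(\Omega;\mathcal N)=\{m\in L^2(\Omega;\mathbb{R}^\ell): m\in\mathcal N\text{ a.e. in }\Omega,\ \mathcal K_\Omega(m)<+\infty\}.$$ Let $(m_k)_{k\in\mathbb N}\subseteq\mathcal X^K(\Omega;\mathcal N)$ be a sequence such that $\sup_{k\in\mathbb N}\mathcal F_\Omega(m_k)<+\infty$. Then there exist a subsequence $(m_{k_h})_h$ and a function $m\in\mathcal X^K(\Omega;\mathcal N)$ such that $$\lim_{h\to\infty}\|m_{k_h}-m\|_{L^2(\Omega;\mathbb{R}^\ell)}=0.$$ -/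

import Mathlib

open MeasureTheory Filter Topology
open scoped ENNReal NNReal

/-- A symmetric Lévy kernel `j : ℝⁿ → [0, ∞]` that is not integrable near the origin. -/
structure IsSingularLevyKernel {n : ℕ} (j : EuclideanSpace ℝ (Fin n) → ℝ≥0∞) : Prop where
  /-- `j` is Lebesgue measurable. -/
  aemeasurable : AEMeasurable j volume
  /-- Symmetry: `j (-z) = j z`. -/
  symm : ∀ z, j (-z) = j z
  /-- Lévy condition: `∫ min {1, |z|²} j(z) dz < ∞`. -/
  levy : (∫⁻ z, ENNReal.ofReal (min 1 (‖z‖ ^ 2)) * j z) < ∞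
  /-- `j ∉ L¹(B_R)` for every `R > 0`. -/
  not_integrable : ∀ R : ℝ, 0 < R → (∫⁻ z in Metric.ball 0 R, j z) = ∞

/-- The space `L²(Ω; ℝ^ℓ)`, for Lebesgue measure on `Ω ⊆ ℝⁿ`. -/
abbrev L2Space {n : ℕ} (Ω : Set (EuclideanSpace ℝ (Fin n))) (l : ℕ) : Type :=
  Lp (EuclideanSpace ℝ (Fin l)) 2 (volume.restrict Ω)

/-- The quadratic energy `𝒦_Ω(m) = ∬_{Ω × Ω} K(x, y) |m(x) - m(y)|² dx dy`, in `[0, ∞]`. -/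
noncomputable def quadraticEnergy {n l : ℕ} (Ω : Set (EuclideanSpace ℝ (Fin n)))
    (K : EuclideanSpace ℝ (Fin n) → EuclideanSpace ℝ (Fin n) → ℝ≥0∞)
    (m : L2Space Ω l) : ℝ≥0∞ :=
  ∫⁻ p, K p.1 p.2 * ENNReal.ofReal (‖m p.1 - m p.2‖ ^ 2)
    ∂((volume.restrict Ω).prod (volume.restrict Ω))

/-- The energy `ℱ_Ω(m) = ∬_{Ω × Ω} K(x, y) ψ(m(x), m(y)) dx dy`, in `[0, ∞]`. -/
noncomputable def psiEnergy {n l : ℕ} (Ω : Set (EuclideanSpace ℝ (Fin n)))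
    (K : EuclideanSpace ℝ (Fin n) → EuclideanSpace ℝ (Fin n) → ℝ≥0∞)
    (ψ : EuclideanSpace ℝ (Fin l) → EuclideanSpace ℝ (Fin l) → ℝ≥0)
    (m : L2Space Ω l) : ℝ≥0∞ :=
  ∫⁻ p, K p.1 p.2 * (ψ (m p.1) (m p.2) : ℝ≥0∞)
    ∂((volume.restrict Ω).prod (volume.restrict Ω))

/-- The space `𝒳^K(Ω; N)` of all `m ∈ L²(Ω; ℝ^ℓ)` with `m ∈ N` a.e. in `Ω` and
`𝒦_Ω(m) < ∞`. -/
def energySpace {n l : ℕ} (Ω : Set (EuclideanSpace ℝ (Fin n)))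
    (N : Set (EuclideanSpace ℝ (Fin l)))
    (K : EuclideanSpace ℝ (Fin n) → EuclideanSpace ℝ (Fin n) → ℝ≥0∞) :
    Set (L2Space Ω l) :=
  {m | (∀ᵐ x ∂(volume.restrict Ω), m x ∈ N) ∧ quadraticEnergy Ω K m < ∞}

/-! The obstacle is upgrading weak to strong `L²` convergence. Truncating `j` gives bounded kernels
`J ≤ j` supported in a small ball with mass at least `1/ε`; their quadratic energies along the
sequence stay below a constant `B` independent of `ε`, since `J ≤ Λ K` and `|p - q|² ≤ Λ ψ`. For a
difference `v` of two terms, expanding the square bounds `∫ (∫ J(x - y) dy) |v(x)|² dx` by the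
energy of `v` plus `2 ∫ ⟨v, J * v⟩`. On most of `Ω` the inner mass is at least `1/ε`, so `‖v‖² ≤ ε
(C + correlation term)` with `C` independent of `ε`. For fixed `ε` the correlation term vanishes
along a weakly convergent subsequence, because a bounded kernel turns weak into strong convergence.
Hence that subsequence is Cauchy (`norm_sub_sq_le_of_kernel`, `exists_subseq_tendsto_of_kernel`).
The limit stays in the energy space by closedness of `N` and Fatou. -/

/-- Bounded sequences in a separable Hilbert space have weakly convergent subsequences. -/
theorem exists_subseq_tendsto_inner {H : Type*} [NormedAddCommGroup H] [InnerProductSpace ℝ H]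
    [CompleteSpace H] [TopologicalSpace.SeparableSpace H] (u : ℕ → H) (R : ℝ)
    (hu : ∀ k, ‖u k‖ ≤ R) :
    ∃ (φ : ℕ → ℕ) (w : H), StrictMono φ ∧
      ∀ g : H, Tendsto (fun k => inner ℝ (u (φ k)) g) atTop (𝓝 (inner ℝ w g)) := by
  have hc := WeakDual.isSeqCompact_closedBall ℝ H (0 : StrongDual ℝ H) R
  obtain ⟨w, -, φ, hφ, hw⟩ := hc (x := fun k =>
    StrongDual.toWeakDual (InnerProductSpace.toDual ℝ H (u k))) (fun k => by simpa using hu k)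
  refine ⟨φ, (InnerProductSpace.toDual ℝ H).symm (WeakDual.toStrongDual w), hφ, fun g => ?_⟩
  have h2 := ((WeakDual.eval_continuous g).tendsto w).comp hw
  rw [InnerProductSpace.toDual_symm_apply]
  exact h2

/-! ### Integral operators with bounded kernels -/

section BoundedKernel

variable {α : Type*} [MeasurableSpace α] {μ : Measure α} [IsFiniteMeasure μ] {l : ℕ}

local notation "V" => EuclideanSpace ℝ (Fin l)

/-- Each coordinate of the integral is the inner product with the `L²` function `f eᵢ`, so weak
convergence applies coordinatewise. -/
theorem tendsto_integral_smul_of_tendsto_inner {u : ℕ → Lp V 2 μ} {w : Lp V 2 μ}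
    (hw : ∀ g : Lp V 2 μ, Tendsto (fun k => inner ℝ (u k) g) atTop (𝓝 (inner ℝ w g)))
    {c : ℝ} {f : α → ℝ} (hf : Measurable f) (hfc : ∀ y, |f y| ≤ c) :
    Tendsto (fun k => ∫ y, f y • u k y ∂μ) atTop (𝓝 (∫ y, f y • w y ∂μ)) := by
  have hint : ∀ v : Lp V 2 μ, Integrable (fun y => f y • v y) μ := fun v =>
    ((Lp.memLp v).integrable (by norm_num)).bdd_smul c hf.aestronglyMeasurable
      (.of_forall hfc)
  have key : ∀ i : Fin l, ∃ g : Lp V 2 μ, ∀ v : Lp V 2 μ,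
      (∫ y, f y • v y ∂μ) i = inner ℝ v g := by
    intro i
    have hg : MemLp (fun y => f y • EuclideanSpace.single i (1 : ℝ)) 2 μ :=
      MemLp.of_bound (hf.smul_const _).aestronglyMeasurable c
        (.of_forall fun y => by simpa [norm_smul] using hfc y)
    refine ⟨hg.toLp _, fun v => ?_⟩
    have h1 : (∫ y, f y • v y ∂μ) i =
        inner ℝ (EuclideanSpace.single i (1 : ℝ)) (∫ y, f y • v y ∂μ) := by
      simp [EuclideanSpace.inner_single_left]
    rw [h1, ← integral_inner (hint v), L2.inner_def]
    refine integral_congr_ae ?_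
    filter_upwards [hg.coeFn_toLp] with y hy
    rw [hy]
    rw [inner_smul_right, inner_smul_right, real_inner_comm]
  choose g hg using key
  have hcoord : Tendsto (fun k => WithLp.ofLp (∫ y, f y • u k y ∂μ)) atTop
      (𝓝 (WithLp.ofLp (∫ y, f y • w y ∂μ))) := by
    refine tendsto_pi_nhds.2 fun i => ?_
    simp only [hg]
    exact hw (g i)
  exact ((PiLp.continuous_toLp 2 (fun _ : Fin l => ℝ)).tendsto _).comp hcoord

/-- Weak convergence gives pointwise convergence in `x`; the uniform bound `M` and finiteness of `μ`
allow dominated convergence. -/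
theorem tendsto_integral_norm_kernel_sub {u : ℕ → Lp V 2 μ} {w : Lp V 2 μ}
    (hw : ∀ g : Lp V 2 μ, Tendsto (fun k => inner ℝ (u k) g) atTop (𝓝 (inner ℝ w g)))
    {M : ℝ} (hM : ∀ k, ∀ᵐ x ∂μ, ‖u k x‖ ≤ M)
    {c : ℝ} {f : α × α → ℝ} (hf : Measurable f) (hfc : ∀ p, |f p| ≤ c) :
    Tendsto (fun k => ∫ x, ‖(∫ y, f (x, y) • u k y ∂μ) - ∫ y, f (x, y) • w y ∂μ‖ ∂μ) atTop
      (𝓝 0) := by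
  have hmeas : ∀ v : Lp V 2 μ,
      AEStronglyMeasurable (fun x => ∫ y, f (x, y) • v y ∂μ) μ := fun v =>
    AEStronglyMeasurable.integral_prod_right' (f := fun p : α × α => f p • v p.2)
      (hf.aestronglyMeasurable.smul (Lp.aestronglyMeasurable v).comp_snd)
  have hlim : ∀ x, Tendsto (fun k => ∫ y, f (x, y) • u k y ∂μ) atTop
      (𝓝 (∫ y, f (x, y) • w y ∂μ)) := fun x =>
    tendsto_integral_smul_of_tendsto_inner hw (hf.comp measurable_prodMk_left) fun y => hfc _
  have hbd : ∀ k x, ‖∫ y, f (x, y) • u k y ∂μ‖ ≤ c * M * μ.real Set.univ := by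
    intro k x
    refine norm_integral_le_of_norm_le_const ?_
    filter_upwards [hM k] with y hy
    rw [norm_smul]
    exact mul_le_mul (hfc _) hy (norm_nonneg _) ((abs_nonneg _).trans (hfc (x, y)))
  have hbd' : ∀ x, ‖∫ y, f (x, y) • w y ∂μ‖ ≤ c * M * μ.real Set.univ := fun x =>
    le_of_tendsto (hlim x).norm (.of_forall fun k => hbd k x)
  have := tendsto_integral_of_dominated_convergence (μ := μ)
    (F := fun k x => ‖(∫ y, f (x, y) • u k y ∂μ) - ∫ y, f (x, y) • w y ∂μ‖) (f := fun _ => 0)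
    (fun _ => c * M * μ.real Set.univ + c * M * μ.real Set.univ)
    (fun k => ((hmeas _).sub (hmeas _)).norm) (integrable_const _)
    (fun k => .of_forall fun x => by
      rw [norm_norm]
      exact (norm_sub_le _ _).trans (add_le_add (hbd k x) (hbd' x)))
    (.of_forall fun x => by
      simpa using ((hlim x).sub_const (∫ y, f (x, y) • w y ∂μ)).norm)
  simpa using this

/-- Integrate `|a|² ≤ |a - b|² + 2⟨a, b⟩`, obtained by dropping `|b|²`, against `f`; no symmetry of
`f` is needed. -/
theorem integral_kernel_mul_norm_sq_le {v : α → V} (hv : AEStronglyMeasurable v μ)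
    {M : ℝ} (hM : ∀ᵐ x ∂μ, ‖v x‖ ≤ M)
    {c : ℝ} {f : α × α → ℝ} (hf : Measurable f) (hf0 : ∀ p, 0 ≤ f p) (hfc : ∀ p, f p ≤ c) :
    ∫ x, (∫ y, f (x, y) ∂μ) * ‖v x‖ ^ 2 ∂μ ≤
      (∫ p, f p * ‖v p.1 - v p.2‖ ^ 2 ∂(μ.prod μ)) +
        2 * ∫ x, inner ℝ (v x) (∫ y, f (x, y) • v y ∂μ) ∂μ := by
  have h1 : ∀ᵐ p ∂(μ.prod μ), ‖v p.1‖ ≤ M := Measure.quasiMeasurePreserving_fst.ae hM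
  have h2 : ∀ᵐ p ∂(μ.prod μ), ‖v p.2‖ ≤ M := Measure.quasiMeasurePreserving_snd.ae hM
  have hvint : Integrable v μ := .of_bound hv M hM
  have hfb : ∀ p, ‖f p‖ ≤ c := fun p => by
    rw [Real.norm_of_nonneg (hf0 p)]; exact hfc p
  have i1 : Integrable (fun p : α × α => f p * ‖v p.1‖ ^ 2) (μ.prod μ) := by
    refine Integrable.bdd_mul (c := c) ?_ hf.aestronglyMeasurable (.of_forall hfb)
    refine .of_bound (hv.comp_fst.norm.pow 2) (M ^ 2) ?_
    filter_upwards [h1] with p hp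
    simp only [norm_pow, norm_norm]; gcongr
  have i2 : Integrable (fun p : α × α => f p * ‖v p.1 - v p.2‖ ^ 2) (μ.prod μ) := by
    refine Integrable.bdd_mul (c := c) ?_ hf.aestronglyMeasurable (.of_forall hfb)
    refine .of_bound ((hv.comp_fst.sub hv.comp_snd).norm.pow 2) ((M + M) ^ 2) ?_
    filter_upwards [h1, h2] with p hp hp'
    simp only [norm_pow, norm_norm]; gcongr
    exact (norm_sub_le _ _).trans (add_le_add hp hp')
  have i3 : Integrable (fun p : α × α => inner ℝ (v p.1) (f p • v p.2)) (μ.prod μ) := by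
    refine .of_bound (hv.comp_fst.inner (hf.aestronglyMeasurable.smul hv.comp_snd))
      (M * (c * M)) ?_
    filter_upwards [h1, h2] with p hp hp'
    refine (norm_inner_le_norm _ _).trans ?_
    rw [norm_smul]
    have := (norm_nonneg _).trans (hfb p)
    have := (norm_nonneg _).trans hp
    gcongr
    exact hfb p
  have e1 : ∫ x, (∫ y, f (x, y) ∂μ) * ‖v x‖ ^ 2 ∂μ =
      ∫ p, f p * ‖v p.1‖ ^ 2 ∂(μ.prod μ) := by
    rw [integral_prod _ i1]
    simp [integral_mul_const]
  have e3 : ∫ x, inner ℝ (v x) (∫ y, f (x, y) • v y ∂μ) ∂μ =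
      ∫ p, inner ℝ (v p.1) (f p • v p.2) ∂(μ.prod μ) := by
    rw [integral_prod _ i3]
    refine integral_congr_ae (.of_forall fun x => ?_)
    exact (integral_inner (hvint.bdd_smul c
      (hf.comp measurable_prodMk_left).aestronglyMeasurable (.of_forall fun y => hfb _)) _).symm
  rw [e1, e3, ← integral_const_mul, ← integral_add i2 (i3.const_mul 2)]
  refine integral_mono i1 (i2.add (i3.const_mul 2)) fun p => ?_
  simp only [inner_smul_right]
  rw [norm_sub_sq_real]
  nlinarith [mul_nonneg (hf0 p) (sq_nonneg ‖v p.2‖)]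

end BoundedKernel

/-! ### From energy bounds to Cauchy sequences -/

section NonlocalCompactness

variable {α : Type*} [MeasurableSpace α] {μ : Measure α} [IsFiniteMeasure μ] {l : ℕ}

local notation "V" => EuclideanSpace ℝ (Fin l)

theorem integral_kernel_norm_sub_sub_le {u v : Lp V 2 μ} {M B : ℝ}
    (hu : ∀ᵐ x ∂μ, ‖u x‖ ≤ M) (hv : ∀ᵐ x ∂μ, ‖v x‖ ≤ M)
    {c : ℝ} {f : α × α → ℝ} (hf : Measurable f) (hf0 : ∀ p, 0 ≤ f p) (hfc : ∀ p, f p ≤ c)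
    (hBu : ∫ p, f p * ‖u p.1 - u p.2‖ ^ 2 ∂(μ.prod μ) ≤ B)
    (hBv : ∫ p, f p * ‖v p.1 - v p.2‖ ^ 2 ∂(μ.prod μ) ≤ B) :
    ∫ p, f p * ‖(u p.1 - v p.1) - (u p.2 - v p.2)‖ ^ 2 ∂(μ.prod μ) ≤ 4 * B := by
  have hint : ∀ w : Lp V 2 μ, (∀ᵐ x ∂μ, ‖w x‖ ≤ M) →
      Integrable (fun p : α × α => f p * ‖w p.1 - w p.2‖ ^ 2) (μ.prod μ) := by
    intro w hw
    refine Integrable.bdd_mul (c := c) ?_ hf.aestronglyMeasurable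
      (.of_forall fun p => by rw [Real.norm_of_nonneg (hf0 p)]; exact hfc p)
    refine .of_bound (((Lp.aestronglyMeasurable w).comp_fst.sub
      (Lp.aestronglyMeasurable w).comp_snd).norm.pow 2) ((M + M) ^ 2) ?_
    filter_upwards [Measure.quasiMeasurePreserving_fst.ae hw,
      Measure.quasiMeasurePreserving_snd.ae hw] with p hp hp'
    simp only [norm_pow, norm_norm]; gcongr
    exact (norm_sub_le _ _).trans (add_le_add hp hp')
  have hle : ∫ p, f p * ‖(u p.1 - v p.1) - (u p.2 - v p.2)‖ ^ 2 ∂(μ.prod μ) ≤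
      ∫ p, (2 * (f p * ‖u p.1 - u p.2‖ ^ 2) + 2 * (f p * ‖v p.1 - v p.2‖ ^ 2)) ∂(μ.prod μ) := by
    refine integral_mono_of_nonneg (.of_forall fun p => mul_nonneg (hf0 p) (sq_nonneg _))
      (((hint u hu).const_mul 2).add ((hint v hv).const_mul 2)) (.of_forall fun p => ?_)
    have h1 : ‖(u p.1 - v p.1) - (u p.2 - v p.2)‖ ^ 2 ≤
        2 * ‖u p.1 - u p.2‖ ^ 2 + 2 * ‖v p.1 - v p.2‖ ^ 2 := by
      rw [sub_sub_sub_comm]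
      have := norm_sub_le (u p.1 - u p.2) (v p.1 - v p.2)
      nlinarith [sq_nonneg (‖u p.1 - u p.2‖ - ‖v p.1 - v p.2‖), norm_nonneg
        (u p.1 - u p.2 - (v p.1 - v p.2))]
    have := mul_le_mul_of_nonneg_left h1 (hf0 p)
    simp only
    linarith
  rw [integral_add ((hint u hu).const_mul 2) ((hint v hv).const_mul 2), integral_const_mul,
    integral_const_mul] at hle
  linarith

/-- On `S` the kernel mass absorbs the factor `1/ε`; off `S` the crude bound `|u - v|² ≤ 4M²` costs
at most `4M²ε`. The function `w`, later the weak limit, enters only through the triangle inequality.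
-/
theorem norm_sub_sq_le_of_kernel {u v w : Lp V 2 μ} {M B : ℝ}
    (hu : ∀ᵐ x ∂μ, ‖u x‖ ≤ M) (hv : ∀ᵐ x ∂μ, ‖v x‖ ≤ M)
    {c : ℝ} {f : α × α → ℝ} (hf : Measurable f) (hf0 : ∀ p, 0 ≤ f p) (hfc : ∀ p, f p ≤ c)
    (hBu : ∫ p, f p * ‖u p.1 - u p.2‖ ^ 2 ∂(μ.prod μ) ≤ B)
    (hBv : ∫ p, f p * ‖v p.1 - v p.2‖ ^ 2 ∂(μ.prod μ) ≤ B)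
    {ε : ℝ} (hε : 0 < ε) {S : Set α} (hS : MeasurableSet S) (hSε : μ.real Sᶜ ≤ ε)
    (hSf : ∀ x ∈ S, 1 ≤ ε * ∫ y, f (x, y) ∂μ) :
    ‖u - v‖ ^ 2 ≤ ε * (4 * B + 4 * M ^ 2 +
      4 * M * (∫ x, ‖(∫ y, f (x, y) • u y ∂μ) - ∫ y, f (x, y) • w y ∂μ‖ ∂μ) +
      4 * M * ∫ x, ‖(∫ y, f (x, y) • v y ∂μ) - ∫ y, f (x, y) • w y ∂μ‖ ∂μ) := by
  have hfb : ∀ p, ‖f p‖ ≤ c := fun p => by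
    rw [Real.norm_of_nonneg (hf0 p)]; exact hfc p
  have hfx : ∀ x, AEStronglyMeasurable (fun y => f (x, y)) μ := fun x =>
    (hf.comp measurable_prodMk_left).aestronglyMeasurable
  have hT : ∀ g : Lp V 2 μ, Integrable (fun x => ∫ y, f (x, y) • g y ∂μ) μ := by
    intro g
    have : Integrable (fun p : α × α => f p • g p.2) (μ.prod μ) :=
      (((Lp.memLp g).integrable (by norm_num)).comp_snd μ).bdd_smul c hf.aestronglyMeasurable
        (.of_forall hfb)
    exact this.integral_prod_left
  have hTw : ∀ g : Lp V 2 μ, Integrable (fun x =>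
      2 * M * ‖(∫ y, f (x, y) • g y ∂μ) - ∫ y, f (x, y) • w y ∂μ‖) μ := fun g =>
    ((hT g).sub (hT w)).norm.const_mul _
  have hsm : ∀ (g : Lp V 2 μ) x, Integrable (fun y => f (x, y) • g y) μ := fun g x =>
    ((Lp.memLp g).integrable (by norm_num)).bdd_smul c (hfx x) (.of_forall fun y => hfb _)
  have hd : AEStronglyMeasurable (fun x => u x - v x) μ :=
    (Lp.aestronglyMeasurable u).sub (Lp.aestronglyMeasurable v)
  have hdM : ∀ᵐ x ∂μ, ‖u x - v x‖ ≤ 2 * M := by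
    filter_upwards [hu, hv] with x h1 h2
    linarith [norm_sub_le (u x) (v x)]
  have hdsq : Integrable (fun x => ‖u x - v x‖ ^ 2) μ := by
    refine .of_bound (hd.norm.pow 2) ((2 * M) ^ 2) ?_
    filter_upwards [hdM] with x hx
    simp only [norm_pow, norm_norm]; gcongr
  have hasq : Integrable (fun x => (∫ y, f (x, y) ∂μ) * ‖u x - v x‖ ^ 2) μ := by
    refine hdsq.bdd_mul (c := c * μ.real Set.univ) ?_ (.of_forall fun x =>
      norm_integral_le_of_norm_le_const (.of_forall fun y => hfb _))
    exact hf.aestronglyMeasurable.integral_prod_right'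
  have e0 : ‖u - v‖ ^ 2 = ∫ x, ‖u x - v x‖ ^ 2 ∂μ := by
    rw [← real_inner_self_eq_norm_sq, L2.inner_def]
    refine integral_congr_ae ?_
    filter_upwards [Lp.coeFn_sub u v] with x hx
    rw [hx, real_inner_self_eq_norm_sq, Pi.sub_apply]
  have hind : Integrable (Sᶜ.indicator fun _ => (4 * M ^ 2 : ℝ)) μ :=
    (integrable_const _).indicator hS.compl
  have e1 : ∫ x, ‖u x - v x‖ ^ 2 ∂μ ≤
      ∫ x, (ε * ((∫ y, f (x, y) ∂μ) * ‖u x - v x‖ ^ 2) +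
        Sᶜ.indicator (fun _ => (4 * M ^ 2 : ℝ)) x) ∂μ := by
    refine integral_mono_ae hdsq ((hasq.const_mul ε).add hind) ?_
    filter_upwards [hdM] with x hx
    by_cases hxS : x ∈ S
    · simp only [Set.indicator_of_notMem (Set.notMem_compl_iff.2 hxS), add_zero]
      nlinarith [hSf x hxS, sq_nonneg ‖u x - v x‖]
    · simp only [Set.indicator_of_mem (Set.mem_compl hxS)]
      have h0 : 0 ≤ ε * ((∫ y, f (x, y) ∂μ) * ‖u x - v x‖ ^ 2) :=
        mul_nonneg hε.le (mul_nonneg (integral_nonneg fun y => hf0 _) (sq_nonneg _))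
      nlinarith [norm_nonneg (u x - v x)]
  rw [integral_add (hasq.const_mul ε) hind, integral_const_mul,
    integral_indicator_const _ hS.compl, smul_eq_mul] at e1
  have e2 := integral_kernel_mul_norm_sq_le hd hdM hf hf0 hfc
  have e3 := integral_kernel_norm_sub_sub_le hu hv hf hf0 hfc hBu hBv
  have e4 : ∫ x, inner ℝ (u x - v x) (∫ y, f (x, y) • (u y - v y) ∂μ) ∂μ ≤
      ∫ x, (2 * M * ‖(∫ y, f (x, y) • u y ∂μ) - ∫ y, f (x, y) • w y ∂μ‖ +
        2 * M * ‖(∫ y, f (x, y) • v y ∂μ) - ∫ y, f (x, y) • w y ∂μ‖) ∂μ := by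
    have hTd : ∀ x, ∫ y, f (x, y) • (u y - v y) ∂μ =
        (∫ y, f (x, y) • u y ∂μ) - ∫ y, f (x, y) • v y ∂μ := fun x => by
      simp only [smul_sub]
      exact integral_sub (hsm u x) (hsm v x)
    simp only [hTd]
    refine integral_mono_ae ?_ ((hTw u).add (hTw v)) ?_
    · refine ((((hT u).sub (hT v)).norm).const_mul (2 * M)).mono'
        (hd.inner ((hT u).sub (hT v)).aestronglyMeasurable) ?_
      filter_upwards [hdM] with x hx
      refine (norm_inner_le_norm _ _).trans ?_
      simp only [Pi.sub_apply]
      gcongr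
    · filter_upwards [hdM] with x hx
      have hM0 : 0 ≤ 2 * M := (norm_nonneg _).trans hx
      rw [← mul_add]
      refine (real_inner_le_norm _ _).trans (mul_le_mul hx ?_ (norm_nonneg _) hM0)
      rw [← sub_sub_sub_cancel_right _ _ (∫ y, f (x, y) • w y ∂μ)]
      exact norm_sub_le _ _
  rw [integral_add (hTw u) (hTw v), integral_const_mul, integral_const_mul] at e4
  rw [e0]
  refine e1.trans ?_
  have e5 := mul_le_mul_of_nonneg_left (e2.trans (add_le_add e3
    (mul_le_mul_of_nonneg_left e4 zero_le_two))) hε.le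
  have e6 := mul_le_mul_of_nonneg_right hSε (show 0 ≤ 4 * M ^ 2 by positivity)
  linarith

/-- A bounded sequence whose nonlocal energies are controlled along a family of bounded kernels
with arbitrarily large mass, outside sets of arbitrarily small measure, is precompact in `L²`. -/
theorem exists_subseq_tendsto_of_kernel {u : ℕ → Lp V 2 μ} {M B : ℝ} (hM0 : 0 ≤ M) (hB0 : 0 ≤ B)
    (hM : ∀ k, ∀ᵐ x ∂μ, ‖u k x‖ ≤ M)
    (H : ∀ ε : ℝ, 0 < ε → ∃ (f : α × α → ℝ) (c : ℝ) (S : Set α), Measurable f ∧ (∀ p, 0 ≤ f p) ∧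
      (∀ p, f p ≤ c) ∧ MeasurableSet S ∧ μ.real Sᶜ ≤ ε ∧
      (∀ x ∈ S, 1 ≤ ε * ∫ y, f (x, y) ∂μ) ∧
      ∀ k, ∫ p, f p * ‖u k p.1 - u k p.2‖ ^ 2 ∂(μ.prod μ) ≤ B)
    [TopologicalSpace.SeparableSpace (Lp V 2 μ)] :
    ∃ (φ : ℕ → ℕ) (w : Lp V 2 μ), StrictMono φ ∧ Tendsto (fun k => u (φ k)) atTop (𝓝 w) := by
  obtain ⟨φ, w, hφ, hw⟩ := exists_subseq_tendsto_inner u _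
    fun k => Lp.norm_le_of_ae_bound hM0 (hM k)
  suffices hC : CauchySeq fun k => u (φ k) by
    obtain ⟨w', hw'⟩ := cauchySeq_tendsto_of_complete hC
    exact ⟨φ, w', hφ, hw'⟩
  refine Metric.cauchySeq_iff.2 fun δ hδ => ?_
  -- With this `ε`, once each of the two correlation terms is below `1/2`, the estimate gives `‖u -
  -- v‖² ≤ δ²/2`.
  have hD : 0 < 4 * B + 4 * M ^ 2 + 1 := by positivity
  have hε : 0 < δ ^ 2 / (2 * (4 * B + 4 * M ^ 2 + 1)) := by positivity
  obtain ⟨f, c, S, hf, hf0, hfc, hS, hSε, hSf, hfB⟩ := H _ hε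
  have hlim := (tendsto_integral_norm_kernel_sub hw (fun k => hM (φ k)) hf (c := c)
    (fun p => by rw [abs_of_nonneg (hf0 p)]; exact hfc p)).const_mul (4 * M)
  rw [mul_zero] at hlim
  obtain ⟨n₀, hn₀⟩ := eventually_atTop.1 (hlim.eventually_lt_const (show (0 : ℝ) < 1 / 2 by norm_num))
  refine ⟨n₀, fun n hn k hk => ?_⟩
  have key := norm_sub_sq_le_of_kernel (w := w) (hM (φ n)) (hM (φ k)) hf hf0 hfc (hfB _) (hfB _)
    hε hS hSε hSf
  rw [dist_eq_norm]
  refine lt_of_pow_lt_pow_left₀ 2 hδ.le (key.trans_lt ?_)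
  calc _ ≤ δ ^ 2 / (2 * (4 * B + 4 * M ^ 2 + 1)) * (4 * B + 4 * M ^ 2 + 1) := by
        refine mul_le_mul_of_nonneg_left ?_ hε.le
        linarith [hn₀ n hn, hn₀ k hk]
    _ = δ ^ 2 / 2 := by field_simp
    _ < δ ^ 2 := half_lt_self (by positivity)

end NonlocalCompactness

/-! ### Truncated kernels and inner sets -/

/-- A kernel of infinite mass near the origin has bounded minorants of arbitrarily large mass
supported near the origin. -/
theorem exists_bounded_minorant {n : ℕ} {j : EuclideanSpace ℝ (Fin n) → ℝ≥0∞}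
    (hj : AEMeasurable j volume) {R : ℝ} (hR : (∫⁻ z in Metric.ball 0 R, j z) = ∞) (L : ℝ) :
    ∃ (J : EuclideanSpace ℝ (Fin n) → ℝ) (c : ℝ), Measurable J ∧ (∀ z, 0 ≤ J z) ∧
      (∀ z, J z ≤ c) ∧ (∀ z, z ∉ Metric.ball 0 R → J z = 0) ∧
      (∀ᵐ z, ENNReal.ofReal (J z) ≤ j z) ∧ L ≤ ∫ z, J z := by
  have hg : Measurable (hj.mk j) := hj.measurable_mk
  have hgR : (∫⁻ z in Metric.ball 0 R, hj.mk j z) = ∞ := by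
    rw [← hR]
    exact lintegral_congr_ae (ae_restrict_of_ae hj.ae_eq_mk.symm)
  have hmono : Monotone fun (k : ℕ) z => min (hj.mk j z) (k : ℝ≥0∞) := fun a b hab z =>
    min_le_min_left _ (by exact_mod_cast hab)
  have hsup : ∀ z, ⨆ k : ℕ, min (hj.mk j z) (k : ℝ≥0∞) = hj.mk j z := fun z => by
    rw [← inf_iSup_eq, ENNReal.iSup_natCast, inf_top_eq]
  have hmeas : ∀ k : ℕ, Measurable fun z => min (hj.mk j z) (k : ℝ≥0∞) := fun k =>
    hg.min measurable_const
  -- Monotone convergence: the truncations at height `k` have masses increasing to infinity.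
  have hlim : ⨆ k : ℕ, ∫⁻ z in Metric.ball 0 R, min (hj.mk j z) (k : ℝ≥0∞) = ∞ := by
    rw [← lintegral_iSup hmeas hmono, ← hgR]
    exact lintegral_congr hsup
  obtain ⟨k, hk⟩ := lt_iSup_iff.1 (hlim.symm ▸ (ENNReal.ofReal_lt_top (r := L)))
  have hlt : ∀ z, min (hj.mk j z) (k : ℝ≥0∞) ≠ ∞ := fun z =>
    ((min_le_right _ _).trans_lt (ENNReal.natCast_lt_top k)).ne
  have hof : ∀ z, ENNReal.ofReal ((Metric.ball 0 R).indicator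
      (fun z => (min (hj.mk j z) (k : ℝ≥0∞)).toReal) z) =
      (Metric.ball 0 R).indicator (fun z => min (hj.mk j z) (k : ℝ≥0∞)) z := by
    intro z
    by_cases hz : z ∈ Metric.ball (0 : EuclideanSpace ℝ (Fin n)) R
    · rw [Set.indicator_of_mem hz, Set.indicator_of_mem hz, ENNReal.ofReal_toReal (hlt z)]
    · rw [Set.indicator_of_notMem hz, Set.indicator_of_notMem hz, ENNReal.ofReal_zero]
  have hJm : Measurable ((Metric.ball 0 R).indicator
      (fun z => (min (hj.mk j z) (k : ℝ≥0∞)).toReal)) :=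
    (hmeas k).ennreal_toReal.indicator measurableSet_ball
  have hJ0 : ∀ z, 0 ≤ (Metric.ball 0 R).indicator
      (fun z => (min (hj.mk j z) (k : ℝ≥0∞)).toReal) z := fun z =>
    Set.indicator_nonneg (fun _ _ => ENNReal.toReal_nonneg) z
  refine ⟨_, k, hJm, hJ0, fun z => ?_, fun z hz => Set.indicator_of_notMem hz _, ?_, ?_⟩
  · refine Set.indicator_le' (fun z _ => ?_) (fun _ _ => k.cast_nonneg) z
    exact ENNReal.toReal_le_of_le_ofReal k.cast_nonneg (by simp)
  · filter_upwards [hj.ae_eq_mk] with z hz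
    rw [hof, hz]
    exact Set.indicator_le (fun z _ => min_le_left _ _) z
  · rw [integral_eq_lintegral_of_nonneg_ae (.of_forall hJ0) hJm.aestronglyMeasurable]
    simp only [hof]
    rw [lintegral_indicator measurableSet_ball]
    refine (ENNReal.ofReal_le_iff_le_toReal ?_).1 hk.le
    refine ((lintegral_mono fun z => min_le_right _ _).trans_lt ?_).ne
    rw [lintegral_const]
    exact ENNReal.mul_lt_top (ENNReal.natCast_lt_top k) (by simpa using measure_ball_lt_top)

/-- Up to arbitrarily small measure, an open set of finite measure consists of points at a
distance bounded below from its complement. -/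
theorem exists_inner_set {E : Type*} [PseudoMetricSpace E] [MeasurableSpace E] [BorelSpace E]
    {μ : Measure E} {Ω : Set E} (hΩ : IsOpen Ω) [IsFiniteMeasure (μ.restrict Ω)]
    {ε : ℝ} (hε : 0 < ε) :
    ∃ (R : ℝ) (S : Set E), 0 < R ∧ MeasurableSet S ∧ (∀ x ∈ S, Metric.ball x R ⊆ Ω) ∧
      (μ.restrict Ω).real Sᶜ ≤ ε := by
  let S : ℕ → Set E := fun k =>
    {x | ENNReal.ofReal (1 / ((k : ℝ) + 1)) ≤ Metric.infEDist x Ωᶜ}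
  have hSm : ∀ k, MeasurableSet (S k) := fun k =>
    (isClosed_le continuous_const Metric.continuous_infEDist).measurableSet
  have hanti : Antitone fun k => (S k)ᶜ := fun a b hab => Set.compl_subset_compl.2 fun x hx =>
    (ENNReal.ofReal_le_ofReal (one_div_le_one_div_of_le (by positivity) (by gcongr))).trans hx
  have hlim := tendsto_measure_iInter_atTop (μ := μ.restrict Ω)
    (fun k => (hSm k).compl.nullMeasurableSet) hanti ⟨0, measure_ne_top _ _⟩
  -- Every point of the open set `Ω` has positive distance to the complement, so it lies in some `S
  -- k`.
  have hzero : (μ.restrict Ω) (⋂ k, (S k)ᶜ) = 0 := by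
    rw [Measure.restrict_apply (.iInter fun k => (hSm k).compl)]
    convert measure_empty (μ := μ)
    refine Set.eq_empty_of_forall_notMem fun x hx => ?_
    obtain ⟨r, hr, hrx⟩ := Metric.exists_real_pos_lt_infEDist_of_notMem_closure
      (x := x) (E := Ωᶜ) (by rw [hΩ.isClosed_compl.closure_eq]; exact fun h => h hx.2)
    obtain ⟨k, hk⟩ := exists_nat_one_div_lt hr
    exact Set.mem_iInter.1 hx.1 k ((ENNReal.ofReal_le_ofReal hk.le).trans hrx.le)
  rw [hzero] at hlim
  obtain ⟨k, hk⟩ := (hlim.eventually_lt_const (ENNReal.ofReal_pos.2 hε)).exists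
  refine ⟨1 / ((k : ℝ) + 1), S k, by positivity, hSm k, fun x hx y hy => ?_,
    ENNReal.toReal_le_of_le_ofReal hε.le hk.le⟩
  by_contra hyΩ
  refine absurd (hx.trans (Metric.infEDist_le_edist_of_mem hyΩ)) (not_le.2 ?_)
  rw [edist_dist, ENNReal.ofReal_lt_ofReal_iff (by positivity), dist_comm]
  exact hy

/-! ### Semicontinuity and comparison of energies -/

/-- Lower semicontinuity of the quadratic energy under a.e. convergence. -/
theorem quadraticEnergy_le_liminf {n l : ℕ} {Ω : Set (EuclideanSpace ℝ (Fin n))}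
    [IsFiniteMeasure (volume.restrict Ω)]
    {K : EuclideanSpace ℝ (Fin n) → EuclideanSpace ℝ (Fin n) → ℝ≥0∞}
    (hK : AEMeasurable (fun p : EuclideanSpace ℝ (Fin n) × EuclideanSpace ℝ (Fin n) =>
      K p.1 p.2) ((volume.restrict Ω).prod (volume.restrict Ω)))
    {u : ℕ → L2Space Ω l} {w : L2Space Ω l}
    (hu : ∀ᵐ x ∂(volume.restrict Ω), Tendsto (fun k => u k x) atTop (𝓝 (w x))) :
    quadraticEnergy Ω K w ≤ liminf (fun k => quadraticEnergy Ω K (u k)) atTop := by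
  refine le_trans ?_ (lintegral_liminf_le' fun k => hK.mul
    (((Lp.aestronglyMeasurable (u k)).comp_fst.sub
      (Lp.aestronglyMeasurable (u k)).comp_snd).norm.pow 2).aemeasurable.ennreal_ofReal)
  refine lintegral_mono_ae ?_
  filter_upwards [Measure.quasiMeasurePreserving_fst.ae hu,
    Measure.quasiMeasurePreserving_snd.ae hu] with p h1 h2
  have h3 : Tendsto (fun k => ENNReal.ofReal (‖u k p.1 - u k p.2‖ ^ 2)) atTop
      (𝓝 (ENNReal.ofReal (‖w p.1 - w p.2‖ ^ 2))) :=
    ENNReal.tendsto_ofReal ((h1.sub h2).norm.pow 2)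
  -- Where `K = ∞`, multiplication by `K` is discontinuous at `0`; but if the limit is `0`, the left
  -- side vanishes.
  rcases eq_or_ne (ENNReal.ofReal (‖w p.1 - w p.2‖ ^ 2)) 0 with h0 | h0
  · rw [h0, mul_zero]; exact zero_le
  · exact (ENNReal.Tendsto.const_mul h3 (.inl h0)).liminf_eq.ge

theorem ae_sub_of_ae {n : ℕ} {P : EuclideanSpace ℝ (Fin n) → Prop} (hP : ∀ᵐ z, P z)
    (Ω : Set (EuclideanSpace ℝ (Fin n))) :
    ∀ᵐ p ∂((volume.restrict Ω).prod (volume.restrict Ω)), P (p.1 - p.2) := by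
  rw [Measure.prod_restrict]
  exact ae_restrict_of_ae ((quasiMeasurePreserving_sub volume volume).ae hP)

theorem integral_kernel_norm_sq_le_psiEnergy {n l : ℕ} {Ω : Set (EuclideanSpace ℝ (Fin n))}
    [IsFiniteMeasure (volume.restrict Ω)] {N : Set (EuclideanSpace ℝ (Fin l))}
    {j : EuclideanSpace ℝ (Fin n) → ℝ≥0∞} {Λ : ℝ} (hΛ : 0 < Λ)
    {ψ : EuclideanSpace ℝ (Fin l) → EuclideanSpace ℝ (Fin l) → ℝ≥0}
    (hψ : ∀ p ∈ N, ∀ q ∈ N, 1 / Λ * ‖p - q‖ ^ 2 ≤ (ψ p q : ℝ))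
    {K : EuclideanSpace ℝ (Fin n) → EuclideanSpace ℝ (Fin n) → ℝ≥0∞}
    (hK : ∀ᵐ p ∂((volume.restrict Ω).prod (volume.restrict Ω)),
      ENNReal.ofReal (1 / Λ) * j (p.1 - p.2) ≤ K p.1 p.2)
    {J : EuclideanSpace ℝ (Fin n) → ℝ} (hJm : Measurable J) (hJ0 : ∀ z, 0 ≤ J z)
    (hJj : ∀ᵐ z, ENNReal.ofReal (J z) ≤ j z)
    {u : L2Space Ω l} (hu : ∀ᵐ x ∂(volume.restrict Ω), u x ∈ N)
    (hfin : psiEnergy Ω K ψ u ≠ ∞) :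
    ∫ p, J (p.1 - p.2) * ‖u p.1 - u p.2‖ ^ 2 ∂((volume.restrict Ω).prod (volume.restrict Ω)) ≤
      Λ ^ 2 * (psiEnergy Ω K ψ u).toReal := by
  have hinv : ENNReal.ofReal Λ * ENNReal.ofReal (1 / Λ) = 1 := by
    rw [← ENNReal.ofReal_mul hΛ.le, mul_one_div_cancel hΛ.ne', ENNReal.ofReal_one]
  have hmeas : AEStronglyMeasurable (fun p : EuclideanSpace ℝ (Fin n) × EuclideanSpace ℝ (Fin n) =>
      J (p.1 - p.2) * ‖u p.1 - u p.2‖ ^ 2) ((volume.restrict Ω).prod (volume.restrict Ω)) :=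
    (hJm.comp measurable_sub).aestronglyMeasurable.mul
      (((Lp.aestronglyMeasurable u).comp_fst.sub (Lp.aestronglyMeasurable u).comp_snd).norm.pow 2)
  rw [integral_eq_lintegral_of_nonneg_ae
    (.of_forall fun p => mul_nonneg (hJ0 _) (sq_nonneg _)) hmeas]
  have hle : ∫⁻ p, ENNReal.ofReal (J (p.1 - p.2) * ‖u p.1 - u p.2‖ ^ 2)
      ∂((volume.restrict Ω).prod (volume.restrict Ω)) ≤
      ENNReal.ofReal (Λ ^ 2) * psiEnergy Ω K ψ u := by
    rw [psiEnergy, ← lintegral_const_mul' _ _ ENNReal.ofReal_ne_top]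
    refine lintegral_mono_ae ?_
    filter_upwards [hK, ae_sub_of_ae hJj Ω, Measure.quasiMeasurePreserving_fst.ae hu,
      Measure.quasiMeasurePreserving_snd.ae hu] with p hp hpJ h1 h2
    have hK' : ENNReal.ofReal (J (p.1 - p.2)) ≤ ENNReal.ofReal Λ * K p.1 p.2 := by
      refine hpJ.trans ?_
      calc j (p.1 - p.2) = ENNReal.ofReal Λ * (ENNReal.ofReal (1 / Λ) * j (p.1 - p.2)) := by
            rw [← mul_assoc, hinv, one_mul]
        _ ≤ _ := by gcongr
    have hψ' : ENNReal.ofReal (‖u p.1 - u p.2‖ ^ 2) ≤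
        ENNReal.ofReal Λ * (ψ (u p.1) (u p.2) : ℝ≥0∞) := by
      rw [← ENNReal.ofReal_coe_nnreal, ← ENNReal.ofReal_mul hΛ.le]
      refine ENNReal.ofReal_le_ofReal ?_
      have := hψ _ h1 _ h2
      rwa [one_div, inv_mul_le_iff₀ hΛ] at this
    rw [ENNReal.ofReal_mul (hJ0 _), pow_two Λ, ENNReal.ofReal_mul hΛ.le]
    refine (mul_le_mul' hK' hψ').trans_eq ?_
    ring
  refine (ENNReal.toReal_mono (ENNReal.mul_ne_top ENNReal.ofReal_ne_top hfin) hle).trans_eq ?_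
  rw [ENNReal.toReal_mul, ENNReal.toReal_ofReal (sq_nonneg Λ)]

theorem quadraticEnergy_le_psiEnergy {n l : ℕ} {Ω : Set (EuclideanSpace ℝ (Fin n))}
    [IsFiniteMeasure (volume.restrict Ω)] {N : Set (EuclideanSpace ℝ (Fin l))}
    {Λ : ℝ} (hΛ : 0 < Λ)
    {ψ : EuclideanSpace ℝ (Fin l) → EuclideanSpace ℝ (Fin l) → ℝ≥0}
    (hψ : ∀ p ∈ N, ∀ q ∈ N, 1 / Λ * ‖p - q‖ ^ 2 ≤ (ψ p q : ℝ))
    {K : EuclideanSpace ℝ (Fin n) → EuclideanSpace ℝ (Fin n) → ℝ≥0∞}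
    {u : L2Space Ω l} (hu : ∀ᵐ x ∂(volume.restrict Ω), u x ∈ N) :
    quadraticEnergy Ω K u ≤ ENNReal.ofReal Λ * psiEnergy Ω K ψ u := by
  rw [psiEnergy, ← lintegral_const_mul' _ _ ENNReal.ofReal_ne_top]
  refine lintegral_mono_ae ?_
  filter_upwards [Measure.quasiMeasurePreserving_fst.ae hu,
    Measure.quasiMeasurePreserving_snd.ae hu] with p h1 h2
  rw [mul_left_comm]
  gcongr
  rw [← ENNReal.ofReal_coe_nnreal, ← ENNReal.ofReal_mul hΛ.le]
  refine ENNReal.ofReal_le_ofReal ?_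
  have := hψ _ h1 _ h2
  rwa [one_div, inv_mul_le_iff₀ hΛ] at this

/-! ### The compactness theorem -/

theorem mainTheorem1 {n l : ℕ}
    (Ω : Set (EuclideanSpace ℝ (Fin n))) (hΩ_open : IsOpen Ω)
    (hΩ_bdd : Bornology.IsBounded Ω)
    (N : Set (EuclideanSpace ℝ (Fin l))) (hN : IsCompact N)
    (j : EuclideanSpace ℝ (Fin n) → ℝ≥0∞) (hj : IsSingularLevyKernel j)
    (Λ : ℝ) (hΛ : 1 ≤ Λ)
    (ψ : EuclideanSpace ℝ (Fin l) → EuclideanSpace ℝ (Fin l) → ℝ≥0)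
    (hψ : ∀ p ∈ N, ∀ q ∈ N,
      1 / Λ * ‖p - q‖ ^ 2 ≤ (ψ p q : ℝ) ∧ (ψ p q : ℝ) ≤ Λ * ‖p - q‖ ^ 2)
    (K : EuclideanSpace ℝ (Fin n) → EuclideanSpace ℝ (Fin n) → ℝ≥0∞)
    (hK_meas : AEMeasurable (fun p : EuclideanSpace ℝ (Fin n) × EuclideanSpace ℝ (Fin n) =>
      K p.1 p.2) ((volume.restrict Ω).prod (volume.restrict Ω)))
    (hK : ∀ᵐ p ∂((volume.restrict Ω).prod (volume.restrict Ω)),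
      ENNReal.ofReal (1 / Λ) * j (p.1 - p.2) ≤ K p.1 p.2)
    (m : ℕ → L2Space Ω l) (hm : ∀ k, m k ∈ energySpace Ω N K)
    (hbound : (⨆ k, psiEnergy Ω K ψ (m k)) < ∞) :
    ∃ (φ : ℕ → ℕ) (m₀ : L2Space Ω l), StrictMono φ ∧ m₀ ∈ energySpace Ω N K ∧
      Tendsto (fun h => ‖m (φ h) - m₀‖) atTop (𝓝 0) := by
  have hΛ0 : 0 < Λ := one_pos.trans_le hΛ
  have hψ' : ∀ p ∈ N, ∀ q ∈ N, 1 / Λ * ‖p - q‖ ^ 2 ≤ (ψ p q : ℝ) := fun p hp q hq =>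
    (hψ p hp q hq).1
  have : IsFiniteMeasure (volume.restrict Ω) :=
    isFiniteMeasure_restrict.2 hΩ_bdd.measure_lt_top.ne
  have : Fact ((2 : ℝ≥0∞) ≠ ∞) := ⟨by norm_num⟩
  have hψle : ∀ k, psiEnergy Ω K ψ (m k) ≤ ⨆ k, psiEnergy Ω K ψ (m k) := fun k =>
    le_iSup (fun k => psiEnergy Ω K ψ (m k)) k
  obtain ⟨M, hM0, hM⟩ := hN.isBounded.exists_pos_norm_le
  obtain ⟨φ, w, hφ, hw⟩ := exists_subseq_tendsto_of_kernel (u := m) hM0.le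
    (B := Λ ^ 2 * (⨆ k, psiEnergy Ω K ψ (m k)).toReal)
    (mul_nonneg (sq_nonneg Λ) ENNReal.toReal_nonneg)
    (fun k => (hm k).1.mono fun x hx => hM _ hx) (by
      intro ε hε
      obtain ⟨R, S, hR, hS, hSΩ, hSε⟩ := exists_inner_set (μ := volume) hΩ_open hε
      obtain ⟨J, c, hJm, hJ0, hJc, hJR, hJj, hJL⟩ :=
        exists_bounded_minorant hj.aemeasurable (hj.not_integrable R hR) (1 / ε)
      refine ⟨fun p => J (p.1 - p.2), c, S, hJm.comp measurable_sub, fun p => hJ0 _,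
        fun p => hJc _, hS, hSε, fun x hx => ?_, fun k => ?_⟩
      -- For `x ∈ S` the support of `J(x - ·)` lies in `Ω`, so restricting to `Ω` loses no mass.
      · rw [setIntegral_eq_integral_of_forall_compl_eq_zero, integral_sub_left_eq_self J volume x]
        · rwa [div_le_iff₀' hε] at hJL
        · intro y hy
          refine hJR _ fun hxy => hy (hSΩ x hx ?_)
          rw [Metric.mem_ball, dist_comm, dist_eq_norm]
          simpa using hxy
      · refine (integral_kernel_norm_sq_le_psiEnergy hΛ0 hψ' hK hJm hJ0 hJj (hm k).1
          ((hψle k).trans_lt hbound).ne).trans ?_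
        gcongr
        exacts [hbound.ne, hψle k])
  refine ⟨φ, w, hφ, ?_, tendsto_iff_norm_sub_tendsto_zero.1 hw⟩
  -- This further extraction only serves to identify the limit's properties; the bounds used below
  -- hold for every index.
  obtain ⟨σ, -, hσ⟩ := (tendstoInMeasure_of_tendsto_Lp hw).exists_seq_tendsto_ae
  refine ⟨?_, (quadraticEnergy_le_liminf (u := fun k => m (φ (σ k))) hK_meas hσ).trans_lt ?_⟩
  · filter_upwards [hσ, ae_all_iff.2 fun k => (hm k).1] with x hx hxN
    exact hN.isClosed.mem_of_tendsto hx (.of_forall fun k => hxN _)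
  · refine lt_of_le_of_lt (liminf_le_of_le (by isBoundedDefault) fun b hb => ?_)
      (ENNReal.mul_lt_top (ENNReal.ofReal_lt_top (r := Λ)) hbound)
    obtain ⟨k, hk⟩ := hb.exists
    exact hk.trans ((quadraticEnergy_le_psiEnergy hΛ0 hψ' (hm _).1).trans (by gcongr; exact hψle _))
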